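/- Let $n\ge 1$ and let $\mathcal F_n$ be the free Heyting algebra on $n$ generators, i.e. the algebra of intuitionistic propositional formulas in $P_1,\dots,P_n$ up to intuitionistic equivalence. Define finite ordered sets $K_n^{-1}=\emptyset\subseteq K_n^0\subseteq K_n^1\subseteq\cdots$, together with valuations $\mathrm{val}\colon K_n^d\to\mathcal P(\{P_1,\dots,P_n\})$, recursively: $K_n^d\setminus K_n^{d-1}$ consists of one point $w_{\beta,Y}$ for each pair $(\beta,Y)$ such that (i) $Y$ is a decreasing subset of $K_n^{d-1}$, with $Y\not\subseteq K_n^{d-2}$ if $d\ge1$; (ii) $\beta\subseteq\{P_1,\dots,P_n\}$ and $\beta\subseteq\mathrm{val}(w')$ for all $w'\in Y$; (iii) if $Y$ is the decreasing set generated by a single point $w'$, then $\beta\ne\mathrm{val}(w')$. Put $\mathrm{val}(w_{\beta,Y})=\beta$, and $w\le w_{\beta,Y}$ iff $w\in Y$ or $w=w_{\beta,Y}$. Let $K_n=\bigcup_d K_n^d$. For an ordered set $X$ let $\mathcal O_\downarrow(X)$ be the Heyting algebra of decreasing subsets of $X$, and put $\widehat{\mathcal F}_n:=\mathcal O_\downarrow(K_n)$.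 Let $a\mapsto[\![a]\!]$ be the homomorphism of Heyting algebras $\mathcal F_n\to\widehat{\mathcal F}_n$ that sends the generator $P_j$ to $\{w\in K_n\mid P_j\in\mathrm{val}(w)\}$. For $i\in\mathbb N$ let $\mathcal F_n^i$ be the quotient of $\mathcal F_n$ by the filter $\{a\mid K_n^i\subseteq[\![a]\!]\}$ and $\pi_i\colon\mathcal F_n\to\mathcal F_n^i$ the canonical epimorphism. Then: 1. For every $i$, the Heyting algebra $\mathcal F_n^i$ is finite, and $\pi_i(a)\mapsto[\![a]\!]\cap K_n^i$ is a well-defined isomorphism $\mathcal F_n^i\to\mathcal O_\downarrow(K_n^i)$. 2. Every finite quotient of $\mathcal F_n$ factors through some $\mathcal F_n^i$: for every surjective homomorphism $f\colon\mathcal F_n\to H$ onto a finite Heyting algebra $H$ there are $i\in\mathbb N$ and a homomorphism $g\colon\mathcal F_n^i\to H$ with $f=g\circ\pi_i$. 3. $\widehat{\mathcal F}_n$ is the projective limit of the $\mathcal F_n^i$: there are homomorphisms $\widehat\pi_i\colon\widehat{\mathcal F}_n\to\mathcal F_n^i$ which correspond to $X\mapsto X\cap K_n^i$ under the isomorphisms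 in 1 and satisfy $\widehat\pi_i([\![a]\!])=\pi_i(a)$ for all $a\in\mathcal F_n$, and with these maps $\widehat{\mathcal F}_n=\varprojlim_{i\in\mathbb N}\mathcal F_n^i$, where the transition maps $\mathcal F_n^j\to\mathcal F_n^i$ ($i\le j$) are the canonical ones. 4. $\widehat{\mathcal F}_n$ is the profinite completion of $\mathcal F_n$, that is, the projective limit of all finite quotients $\mathcal F_n/\Phi$ ($\Phi$ a filter with finite quotient), with respect to homomorphisms $\widehat{\mathcal F}_n\to\mathcal F_n/\Phi$ which send $[\![a]\!]$ to the class of $a$ for all $a\in\mathcal F_n$ and which coincide with $\widehat\pi_i$ when $\mathcal F_n/\Phi=\mathcal F_n^i$. -/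

import Mathlib

/-! ## Intuitionistic propositional logic and the free Heyting algebra -/

/-- Intuitionistic propositional formulas in the variables `P_0, …, P_{n-1}`. -/
inductive Fml (n : ℕ) : Type
  | var : Fin n → Fml n
  | bot : Fml n
  | and : Fml n → Fml n → Fml n
  | or : Fml n → Fml n → Fml n
  | imp : Fml n → Fml n → Fml n

/-- `Entails φ ψ`: the formula `ψ` is derivable from `φ` in intuitionistic propositional logic. -/
inductive Entails {n : ℕ} : Fml n → Fml n → Prop
  | refl (φ) : Entails φ φ
  | trans {φ ψ χ} : Entails φ ψ → Entails ψ χ → Entails φ χ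
  | bot_elim (φ) : Entails .bot φ
  | and_left (φ ψ) : Entails (.and φ ψ) φ
  | and_right (φ ψ) : Entails (.and φ ψ) ψ
  | and_intro {χ φ ψ} : Entails χ φ → Entails χ ψ → Entails χ (.and φ ψ)
  | or_left (φ ψ) : Entails φ (.or φ ψ)
  | or_right (φ ψ) : Entails ψ (.or φ ψ)
  | or_elim {φ ψ χ} : Entails φ χ → Entails ψ χ → Entails (.or φ ψ) χ
  | imp_intro {χ φ ψ} : Entails (.and χ φ) ψ → Entails χ (.imp φ ψ)
  | imp_elim {χ φ ψ} : Entails χ (.imp φ ψ) → Entails (.and χ φ) ψ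

theorem Entails.and_mono {n : ℕ} {φ φ' ψ ψ' : Fml n} (h : Entails φ φ') (k : Entails ψ ψ') :
    Entails (.and φ ψ) (.and φ' ψ') :=
  .and_intro (.trans (.and_left _ _) h) (.trans (.and_right _ _) k)

theorem Entails.or_mono {n : ℕ} {φ φ' ψ ψ' : Fml n} (h : Entails φ φ') (k : Entails ψ ψ') :
    Entails (.or φ ψ) (.or φ' ψ') :=
  .or_elim (.trans h (.or_left _ _)) (.trans k (.or_right _ _))

theorem Entails.imp_mono {n : ℕ} {φ φ' ψ ψ' : Fml n} (h : Entails φ' φ) (k : Entails ψ ψ') :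
    Entails (.imp φ ψ) (.imp φ' ψ') :=
  .imp_intro (.trans (.trans (.and_mono (.refl _) h) (.imp_elim (.refl _))) k)

/-- Intuitionistic equivalence of formulas. -/
instance Fml.setoid (n : ℕ) : Setoid (Fml n) where
  r φ ψ := Entails φ ψ ∧ Entails ψ φ
  iseqv := ⟨fun φ => ⟨.refl φ, .refl φ⟩, fun h => ⟨h.2, h.1⟩,
    fun h k => ⟨.trans h.1 k.1, .trans k.2 h.2⟩⟩

/-- The free Heyting algebra over `n` generators: formulas up to intuitionistic equivalence. -/
def Fr (n : ℕ) : Type := Quotient (Fml.setoid n)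

namespace Fr

variable {n : ℕ}

/-- The class of a formula. -/
def mk (φ : Fml n) : Fr n := Quotient.mk (Fml.setoid n) φ

instance : HeytingAlgebra (Fr n) where
  le := Quotient.lift₂ Entails fun _ _ _ _ h k => propext
    ⟨fun e => .trans h.2 (.trans e k.1), fun e => .trans h.1 (.trans e k.2)⟩
  le_refl := by rintro ⟨φ⟩; exact Entails.refl φ
  le_trans := by rintro ⟨φ⟩ ⟨ψ⟩ ⟨χ⟩ h k; exact Entails.trans h k
  le_antisymm := by rintro ⟨φ⟩ ⟨ψ⟩ h k; exact Quotient.sound ⟨h, k⟩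
  sup := Quotient.map₂ Fml.or fun _ _ h _ _ k => ⟨.or_mono h.1 k.1, .or_mono h.2 k.2⟩
  le_sup_left := by rintro ⟨φ⟩ ⟨ψ⟩; exact Entails.or_left φ ψ
  le_sup_right := by rintro ⟨φ⟩ ⟨ψ⟩; exact Entails.or_right φ ψ
  sup_le := by rintro ⟨φ⟩ ⟨ψ⟩ ⟨χ⟩ h k; exact Entails.or_elim h k
  inf := Quotient.map₂ Fml.and fun _ _ h _ _ k => ⟨.and_mono h.1 k.1, .and_mono h.2 k.2⟩
  inf_le_left := by rintro ⟨φ⟩ ⟨ψ⟩; exact Entails.and_left φ ψ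
  inf_le_right := by rintro ⟨φ⟩ ⟨ψ⟩; exact Entails.and_right φ ψ
  le_inf := by rintro ⟨φ⟩ ⟨ψ⟩ ⟨χ⟩ h k; exact Entails.and_intro h k
  top := mk (.imp .bot .bot)
  le_top := by rintro ⟨φ⟩; exact Entails.imp_intro (.and_right _ _)
  himp := Quotient.map₂ Fml.imp fun _ _ h _ _ k => ⟨.imp_mono h.2 k.1, .imp_mono h.1 k.2⟩
  le_himp_iff := by
    rintro ⟨φ⟩ ⟨ψ⟩ ⟨χ⟩
    exact ⟨Entails.imp_elim, Entails.imp_intro⟩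
  bot := mk .bot
  bot_le := by rintro ⟨φ⟩; exact Entails.bot_elim φ
  compl := Quotient.map (fun φ => Fml.imp φ .bot)
    fun _ _ h => ⟨.imp_mono h.2 (.refl _), .imp_mono h.1 (.refl _)⟩
  himp_bot := by rintro ⟨φ⟩; rfl

/-- The free generators. -/
def gen (j : Fin n) : Fr n := mk (.var j)

variable {H : Type*} [HeytingAlgebra H]

/-- Evaluation of formulas in a Heyting algebra. -/
def eval (g : Fin n → H) : Fml n → H
  | .var j => g j
  | .bot => ⊥
  | .and φ ψ => eval g φ ⊓ eval g ψ
  | .or φ ψ => eval g φ ⊔ eval g ψ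
  | .imp φ ψ => eval g φ ⇨ eval g ψ

theorem eval_mono (g : Fin n → H) {φ ψ : Fml n} (h : Entails φ ψ) : eval g φ ≤ eval g ψ := by
  induction h with
  | refl => exact le_rfl
  | trans _ _ h k => exact h.trans k
  | bot_elim => exact bot_le
  | and_left => exact inf_le_left
  | and_right => exact inf_le_right
  | and_intro _ _ h k => exact le_inf h k
  | or_left => exact le_sup_left
  | or_right => exact le_sup_right
  | or_elim _ _ h k => exact sup_le h k
  | imp_intro _ h => exact le_himp_iff.2 h
  | imp_elim _ h => exact le_himp_iff.1 h

/-- The homomorphism out of the free Heyting algebra with prescribed values on the generators. -/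
def lift (g : Fin n → H) : HeytingHom (Fr n) H where
  toFun := Quotient.lift (eval g) fun _ _ h => le_antisymm (eval_mono g h.1) (eval_mono g h.2)
  map_sup' := by rintro ⟨φ⟩ ⟨ψ⟩; rfl
  map_inf' := by rintro ⟨φ⟩ ⟨ψ⟩; rfl
  map_bot' := rfl
  map_himp' := by rintro ⟨φ⟩ ⟨ψ⟩; rfl

/-- The universal property of the free Heyting algebra. -/
theorem existsUnique_lift (g : Fin n → H) :
    ∃! f : HeytingHom (Fr n) H, ∀ j, f (gen j) = g j := by
  refine ⟨lift g, fun _ => rfl, fun f hf => ?_⟩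
  ext ⟨φ⟩
  change f (mk φ) = eval g φ
  induction φ with
  | var j => exact hf j
  | bot => exact map_bot f
  | and φ ψ h k => exact (map_inf f (mk φ) (mk ψ)).trans (congrArg₂ _ h k)
  | or φ ψ h k => exact (map_sup f (mk φ) (mk ψ)).trans (congrArg₂ _ h k)
  | imp φ ψ h k => exact (map_himp f (mk φ) (mk ψ)).trans (congrArg₂ _ h k)

end Fr

/-! ## Quotients of Heyting algebras by filters, and projective limits -/

section Quotients

open Order

variable {A : Type*} [HeytingAlgebra A]

theorem himp_trans_mem (Φ : PFilter A) {a b c : A} (h : a ⇨ b ∈ Φ) (k : b ⇨ c ∈ Φ) :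
    a ⇨ c ∈ Φ := by
  refine PFilter.mem_of_le ?_ (PFilter.inf_mem h k)
  rw [le_himp_iff, inf_comm, ← inf_assoc, inf_himp]
  exact (inf_le_inf_right _ inf_le_right).trans (by rw [inf_himp]; exact inf_le_right)

/-- The congruence of a filter `Φ`: `a ≡ b` iff `(a → b) ⊓ (b → a) ∈ Φ`. -/
def filterSetoid (Φ : PFilter A) : Setoid A where
  r a b := (a ⇨ b) ⊓ (b ⇨ a) ∈ Φ
  iseqv := by
    simp only [PFilter.inf_mem_iff]
    exact ⟨fun a => by simp, fun h => ⟨h.2, h.1⟩,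
      fun h k => ⟨himp_trans_mem Φ h.1 k.1, himp_trans_mem Φ k.2 h.2⟩⟩

/-- The quotient Heyting algebra `A / ≡_Φ`. -/
def HQuot (Φ : PFilter A) : Type _ := Quotient (filterSetoid Φ)

theorem himp_mem_of_le (Φ : PFilter A) {a b : A} (h : a ≤ b) : a ⇨ b ∈ Φ := by
  rw [himp_eq_top_iff.2 h]; exact PFilter.top_mem

theorem inf_himp_inf_mem (Φ : PFilter A) {a a' b b' : A} (h : a ⇨ a' ∈ Φ) (k : b ⇨ b' ∈ Φ) :
    a ⊓ b ⇨ a' ⊓ b' ∈ Φ := by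
  rw [himp_inf_distrib]
  exact PFilter.inf_mem (himp_trans_mem Φ (himp_mem_of_le Φ inf_le_left) h)
    (himp_trans_mem Φ (himp_mem_of_le Φ inf_le_right) k)

theorem sup_himp_sup_mem (Φ : PFilter A) {a a' b b' : A} (h : a ⇨ a' ∈ Φ) (k : b ⇨ b' ∈ Φ) :
    a ⊔ b ⇨ a' ⊔ b' ∈ Φ := by
  rw [sup_himp_distrib]
  exact PFilter.inf_mem (himp_trans_mem Φ h (himp_mem_of_le Φ le_sup_left))
    (himp_trans_mem Φ k (himp_mem_of_le Φ le_sup_right))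

theorem himp_himp_himp_mem (Φ : PFilter A) {a a' b b' : A} (h : a' ⇨ a ∈ Φ) (k : b ⇨ b' ∈ Φ) :
    (a ⇨ b) ⇨ (a' ⇨ b') ∈ Φ := by
  rw [himp_himp]
  refine himp_trans_mem Φ (b := b) ?_ k
  refine himp_trans_mem Φ (b := (a ⇨ b) ⊓ a)
    (inf_himp_inf_mem Φ (himp_mem_of_le Φ le_rfl) h) (himp_mem_of_le Φ ?_)
  rw [inf_comm, inf_himp]
  exact inf_le_right

instance (Φ : PFilter A) : HeytingAlgebra (HQuot Φ) where
  le := Quotient.lift₂ (fun a b => a ⇨ b ∈ Φ) fun _ _ _ _ h k => by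
    have h := PFilter.inf_mem_iff.1 h
    have k := PFilter.inf_mem_iff.1 k
    exact propext ⟨fun e => himp_trans_mem Φ h.2 (himp_trans_mem Φ e k.1),
      fun e => himp_trans_mem Φ h.1 (himp_trans_mem Φ e k.2)⟩
  le_refl := by rintro ⟨a⟩; exact himp_mem_of_le Φ le_rfl
  le_trans := by rintro ⟨a⟩ ⟨b⟩ ⟨c⟩ h k; exact himp_trans_mem Φ h k
  le_antisymm := by rintro ⟨a⟩ ⟨b⟩ h k; exact Quotient.sound (PFilter.inf_mem h k)
  sup := Quotient.map₂ (· ⊔ ·) fun _ _ h _ _ k => by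
    have h := PFilter.inf_mem_iff.1 h
    have k := PFilter.inf_mem_iff.1 k
    exact PFilter.inf_mem (sup_himp_sup_mem Φ h.1 k.1) (sup_himp_sup_mem Φ h.2 k.2)
  le_sup_left := by rintro ⟨a⟩ ⟨b⟩; exact himp_mem_of_le Φ le_sup_left
  le_sup_right := by rintro ⟨a⟩ ⟨b⟩; exact himp_mem_of_le Φ le_sup_right
  sup_le := by
    rintro ⟨a⟩ ⟨b⟩ ⟨c⟩ h k
    change (a ⊔ b) ⇨ c ∈ Φ
    rw [sup_himp_distrib]
    exact PFilter.inf_mem h k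
  inf := Quotient.map₂ (· ⊓ ·) fun _ _ h _ _ k => by
    have h := PFilter.inf_mem_iff.1 h
    have k := PFilter.inf_mem_iff.1 k
    exact PFilter.inf_mem (inf_himp_inf_mem Φ h.1 k.1) (inf_himp_inf_mem Φ h.2 k.2)
  inf_le_left := by rintro ⟨a⟩ ⟨b⟩; exact himp_mem_of_le Φ inf_le_left
  inf_le_right := by rintro ⟨a⟩ ⟨b⟩; exact himp_mem_of_le Φ inf_le_right
  le_inf := by
    rintro ⟨a⟩ ⟨b⟩ ⟨c⟩ h k
    change a ⇨ (b ⊓ c) ∈ Φ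
    rw [himp_inf_distrib]
    exact PFilter.inf_mem h k
  top := Quotient.mk _ ⊤
  le_top := by rintro ⟨a⟩; exact himp_mem_of_le Φ le_top
  himp := Quotient.map₂ (· ⇨ ·) fun _ _ h _ _ k => by
    have h := PFilter.inf_mem_iff.1 h
    have k := PFilter.inf_mem_iff.1 k
    exact PFilter.inf_mem (himp_himp_himp_mem Φ h.2 k.1) (himp_himp_himp_mem Φ h.1 k.2)
  le_himp_iff := by
    rintro ⟨a⟩ ⟨b⟩ ⟨c⟩
    change a ⇨ (b ⇨ c) ∈ Φ ↔ (a ⊓ b) ⇨ c ∈ Φ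
    rw [himp_himp]
  bot := Quotient.mk _ ⊥
  bot_le := by rintro ⟨a⟩; exact himp_mem_of_le Φ bot_le
  compl := Quotient.map (fun a => a ⇨ ⊥) fun _ _ h => by
    have h := PFilter.inf_mem_iff.1 h
    exact PFilter.inf_mem (himp_himp_himp_mem Φ h.2 (himp_mem_of_le Φ le_rfl))
      (himp_himp_himp_mem Φ h.1 (himp_mem_of_le Φ le_rfl))
  himp_bot := by rintro ⟨a⟩; rfl

/-- The canonical epimorphism `A → A / ≡_Φ`. -/
def HQuot.mk (Φ : PFilter A) : HeytingHom A (HQuot Φ) where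
  toFun := Quotient.mk (filterSetoid Φ)
  map_sup' _ _ := rfl
  map_inf' _ _ := rfl
  map_bot' := rfl
  map_himp' _ _ := rfl

/-- The homomorphism `A / ≡_Φ → B` induced by a homomorphism `f : A → B` that maps `Φ` to `⊤`. -/
def HQuot.lift {B : Type*} [HeytingAlgebra B] (Φ : PFilter A) (f : HeytingHom A B)
    (hf : ∀ a ∈ Φ, f a = ⊤) : HeytingHom (HQuot Φ) B where
  toFun := Quotient.lift f fun a b h => by
    have h := PFilter.inf_mem_iff.1 h
    have h1 := hf _ h.1
    have h2 := hf _ h.2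
    rw [map_himp, himp_eq_top_iff] at h1 h2
    exact le_antisymm h1 h2
  map_sup' := by rintro ⟨a⟩ ⟨b⟩; exact map_sup f a b
  map_inf' := by rintro ⟨a⟩ ⟨b⟩; exact map_inf f a b
  map_bot' := map_bot f
  map_himp' := by rintro ⟨a⟩ ⟨b⟩; exact map_himp f a b

theorem HQuot.mk_eq_top (Φ : PFilter A) {a : A} (h : a ∈ Φ) : HQuot.mk Φ a = ⊤ :=
  Quotient.sound (s := filterSetoid Φ)
    (PFilter.inf_mem (himp_mem_of_le Φ le_top) (by rw [top_himp]; exact h))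

/-- The canonical epimorphism `A / ≡_Φ → A / ≡_Ψ` for filters `Φ ⊆ Ψ`. -/
def HQuot.factor {Φ Ψ : PFilter A} (h : Φ ≤ Ψ) : HeytingHom (HQuot Φ) (HQuot Ψ) :=
  HQuot.lift Φ (HQuot.mk Ψ) fun _ ha => HQuot.mk_eq_top Ψ (h ha)

/-- The Heyting algebra `L` with the homomorphisms `p i : L → F i` is the projective limit of the
system of Heyting algebras `F i` with transition homomorphisms `f i j : F j → F i` for `i ≤ j`:
the `p i` are compatible with the transition maps, and `x ↦ (p i x)_i` is a bijection (hence an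
isomorphism) of `L` onto the algebra of compatible families in the product of the `F i`. -/
structure IsProjLimit {ι : Type*} [Preorder ι] (F : ι → Type*) [∀ i, HeytingAlgebra (F i)]
    (f : ∀ i j, i ≤ j → HeytingHom (F j) (F i)) (L : Type*) [HeytingAlgebra L]
    (p : ∀ i, HeytingHom L (F i)) : Prop where
  compat : ∀ i j (h : i ≤ j) (x : L), f i j h (p j x) = p i x
  existsUnique : ∀ y : ∀ i, F i, (∀ i j (h : i ≤ j), f i j h (y j) = y i) → ∃! x : L, ∀ i, p i x = y i

/-- The filters of `A` with finite quotient, ordered by reverse inclusion. -/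
def FinFilter (A : Type*) [HeytingAlgebra A] : Type _ := {Φ : PFilter A // Finite (HQuot Φ)}

instance : Preorder (FinFilter A) := Preorder.lift fun Φ => OrderDual.toDual Φ.1

/-- The Heyting algebra `L` with the homomorphisms `q Φ : L → A / ≡_Φ` is the profinite completion
of `A`, the projective limit of all finite quotients of `A`. -/
def IsProfiniteCompletion (A : Type*) [HeytingAlgebra A] (L : Type*) [HeytingAlgebra L]
    (q : ∀ Φ : FinFilter A, HeytingHom L (HQuot Φ.1)) : Prop :=
  IsProjLimit (fun Φ : FinFilter A => HQuot Φ.1) (fun _ _ h => HQuot.factor h) L q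

end Quotients

/-! ## The generic Kripke model `K_n` -/

/-- The formal symbols `w_{β,Y}`, with `β` a valuation (a set of variables) and `Y` a finite set of
symbols. The members of `Y` are given by their codes in `ℕ`. -/
structure Symb (n : ℕ) where
  /-- The valuation `β`. -/
  val : Finset (Fin n)
  /-- The codes of the members of `Y`. -/
  codes : Finset ℕ

namespace Symb

variable {n : ℕ}

/-- An injective coding of the symbols by natural numbers. -/
def code (w : Symb n) : ℕ := Encodable.encode (w.val, w.codes)

theorem code_injective : Function.Injective (code : Symb n → ℕ) := by
  rintro ⟨a, b⟩ ⟨c, d⟩ h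
  have h := Encodable.encode_injective h
  cases h
  rfl

/-- The set `Y` of a symbol `w_{β,Y}`. -/
def below (w : Symb n) : Set (Symb n) := {v | v.code ∈ w.codes}

/-- The relation `v ≤ w_{β,Y}`: `v ∈ Y` or `v = w_{β,Y}`. -/
def Le (v w : Symb n) : Prop := v ∈ w.below ∨ v = w

/-- `w = w_{β,Y}` is one of the points added to `K = K_n^{d-1}` in order to get `K_n^d`, where
`d ≥ 1` and `K' = K_n^{d-2}`. -/
structure IsNew (K K' : Set (Symb n)) (w : Symb n) : Prop where
  /-- `Y` is a subset of `K`. -/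
  codes_subset : (w.codes : Set ℕ) ⊆ code '' K
  /-- `Y` is decreasing. -/
  decreasing : ∀ v ∈ w.below, ∀ u ∈ K, Le u v → u ∈ w.below
  not_subset : ¬ w.below ⊆ K'
  val_subset : ∀ v ∈ w.below, w.val ⊆ v.val
  /-- If `Y` is the decreasing set generated by `v`, then `β` is not the valuation of `v`. -/
  val_ne : ∀ v ∈ K, w.below = {u | u ∈ K ∧ Le u v} → w.val ≠ v.val

/-- `stage n d` is `K_n^{d-1}`, as a set of symbols. -/
def stage (n : ℕ) : ℕ → Set (Symb n)
  | 0 => ∅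
  | 1 => {w | w.codes = ∅}
  | d + 2 => stage n (d + 1) ∪ {w | IsNew (stage n (d + 1)) (stage n d) w}

theorem stage_mono : Monotone (stage n) := by
  refine monotone_nat_of_le_succ fun d => ?_
  match d with
  | 0 => exact Set.empty_subset _
  | d + 1 => exact Set.subset_union_left

theorem below_subset : ∀ {d : ℕ} {w : Symb n}, w ∈ stage n (d + 1) → w.below ⊆ stage n d
  | 0, w, h => by
    intro v hv
    have h : w.codes = ∅ := h
    simp [below, h] at hv
  | d + 1, w, h => by
    rcases h with h | h
    · exact (below_subset h).trans (stage_mono d.le_succ)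
    · intro v hv
      obtain ⟨u, hu, e⟩ := h.codes_subset hv
      exact code_injective e ▸ hu

theorem below_trans : ∀ {d : ℕ} {u v w : Symb n}, w ∈ stage n d → v ∈ w.below → u ∈ v.below →
    u ∈ w.below
  | 1, u, v, w, h, hv, _ => absurd (below_subset h hv) (Set.notMem_empty _)
  | d + 2, u, v, w, h, hv, hu => by
    have hv' := below_subset h hv
    rcases h with h | h
    · exact below_trans h hv hu
    · exact h.decreasing v hv u (stage_mono d.le_succ (below_subset hv' hu)) (Or.inl hu)

theorem notMem_below {d : ℕ} : ∀ {v w : Symb n}, w ∈ stage n d → v ∈ w.below → w ∉ v.below := by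
  induction d with
  | zero => exact fun h => absurd h (Set.notMem_empty _)
  | succ d ih => exact fun h hv hw => ih (below_subset h hv) hw hv

theorem val_subset_of_mem_below : ∀ {d : ℕ} {v w : Symb n}, w ∈ stage n d → v ∈ w.below →
    w.val ⊆ v.val
  | 1, _, _, h, hv => absurd (below_subset h hv) (Set.notMem_empty _)
  | _ + 2, v, _, h, hv => by
    rcases h with h | h
    · exact val_subset_of_mem_below h hv
    · exact h.val_subset v hv

/-- Every `K_n^{d-1}` is finite. -/
theorem stage_finite (n d : ℕ) : (stage n d).Finite := by
  match d with
  | 0 => exact Set.finite_empty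
  | 1 =>
    refine (Set.finite_range fun b : Finset (Fin n) => (⟨b, ∅⟩ : Symb n)).subset ?_
    rintro ⟨b, c⟩ h
    exact ⟨b, by cases (h : c = ∅); rfl⟩
  | d + 2 =>
    have hf := ((stage_finite n (d + 1)).image code).toFinset.powerset.finite_toSet
    refine (stage_finite n (d + 1)).union ((((Set.finite_univ (α := Finset (Fin n))).prod hf).image
      fun p => (⟨p.1, p.2⟩ : Symb n)).subset ?_)
    rintro ⟨b, c⟩ h
    refine ⟨(b, c), ⟨trivial, ?_⟩, rfl⟩
    simp only [Finset.coe_powerset, Set.mem_preimage, Set.mem_powerset_iff, Set.Finite.coe_toFinset]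
    exact h.codes_subset

/-- Every pair `(β, Y)` with `Y ⊆ K_n^{d-1}` is given by exactly one symbol `w_{β,Y}`. -/
theorem existsUnique_symb {d : ℕ} (β : Finset (Fin n)) {Y : Set (Symb n)} (hY : Y ⊆ stage n d) :
    ∃! w : Symb n, w.val = β ∧ w.below = Y ∧ (w.codes : Set ℕ) ⊆ code '' stage n d := by
  have hf := ((stage_finite n d).subset hY).image code
  refine ⟨⟨β, hf.toFinset⟩, ⟨rfl, ?_, by simpa using Set.image_mono hY⟩, ?_⟩
  · ext v
    simp [below, code_injective.eq_iff]
  · rintro ⟨b, c⟩ ⟨rfl, h, k⟩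
    congr
    ext m
    rw [Set.Finite.mem_toFinset]
    constructor
    · intro hm
      obtain ⟨v, hv, rfl⟩ := k hm
      exact ⟨v, h ▸ hm, rfl⟩
    · rintro ⟨v, hv, rfl⟩
      rw [← h] at hv
      exact hv

end Symb

/-- The set `K_n` of points of the generic Kripke model, the union of the `K_n^i`. -/
def KPt (n : ℕ) : Type := {w : Symb n // ∃ d, w ∈ Symb.stage n d}

instance (n : ℕ) : PartialOrder (KPt n) where
  le v w := Symb.Le v.1 w.1
  le_refl v := Or.inr rfl
  le_trans u v w := by
    rintro (h | h) (k | k)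
    · exact Or.inl (Symb.below_trans w.2.choose_spec k h)
    · exact Or.inl (k ▸ h)
    · exact Or.inl (h ▸ k)
    · exact Or.inr (h.trans k)
  le_antisymm v w := by
    rintro (h | h) (k | k)
    · exact absurd k (Symb.notMem_below w.2.choose_spec h)
    · exact Subtype.ext k.symm
    · exact Subtype.ext h
    · exact Subtype.ext h

/-- The subset `K_n^i` of `K_n`, with the induced order. -/
def KLevel (n i : ℕ) : Set (KPt n) := {w | w.1 ∈ Symb.stage n (i + 1)}

theorem KLevel_isLowerSet (n i : ℕ) : IsLowerSet (KLevel n i) := by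
  intro w v h hw
  rcases h with h | h
  · exact Symb.stage_mono i.le_succ (Symb.below_subset hw h)
  · exact (Subtype.ext h : v = w) ▸ hw

theorem KLevel_mono (n : ℕ) : Monotone (KLevel n) :=
  fun _ _ h _ hw => Symb.stage_mono (Nat.succ_le_succ h) hw

/-- The valuations of the points of `K_n` are monotone. -/
theorem KPt.val_subset_of_le {n : ℕ} {v w : KPt n} (h : v ≤ w) : w.1.val ⊆ v.1.val := by
  rcases h with h | h
  · exact Symb.val_subset_of_mem_below w.2.choose_spec h
  · exact (Subtype.ext h : v = w) ▸ subset_rfl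

/-! ## The Heyting algebras `O_↓(K_n)` and the quotients of the free Heyting algebra -/

/-- `O_↓(K_n, ≤)`, the Heyting algebra of decreasing subsets of `K_n`. -/
abbrev FrHat (n : ℕ) : Type := LowerSet (KPt n)

/-- The homomorphism `φ ↦ ⟦φ⟧` from the free Heyting algebra to `O_↓(K_n)`, which sends the `j`-th
generator to the set of points at which the `j`-th variable is true. -/
def interp (n : ℕ) : HeytingHom (Fr n) (FrHat n) :=
  Fr.lift fun j => ⟨{w | j ∈ w.1.val}, fun _ _ h hw => KPt.val_subset_of_le h hw⟩

theorem LowerSet.mem_himp_iff {X : Type*} [PartialOrder X] (a b : LowerSet X) (w : X) :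
    w ∈ a ⇨ b ↔ ∀ v ≤ w, v ∈ a → v ∈ b := by
  rw [← LowerSet.Iic_le, le_himp_iff]
  exact ⟨fun h v hv ha => h ⟨hv, ha⟩, fun h v hv => h v hv.1 hv.2⟩

/-- Truncation `X ↦ X ∩ K_n^i`, as a homomorphism `O_↓(K_n) → O_↓(K_n^i)`. -/
def trunc (n i : ℕ) : HeytingHom (FrHat n) (LowerSet (KLevel n i)) where
  toFun X := ⟨{w | (w : KPt n) ∈ X}, fun _ _ h hw => X.lower h hw⟩
  map_sup' _ _ := rfl
  map_inf' _ _ := rfl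
  map_bot' := rfl
  map_himp' a b := by
    ext w
    refine Iff.trans (LowerSet.mem_himp_iff a b (w : KPt n)) (Iff.trans ?_
      (LowerSet.mem_himp_iff _ _ w).symm)
    exact ⟨fun h v hv ha => h v hv ha,
      fun h v hv ha => h ⟨v, KLevel_isLowerSet n i hv w.2⟩ hv ha⟩

/-- The filter of all `a` in the free Heyting algebra with `K_n^i ⊆ ⟦a⟧`. -/
def levelFilter (n i : ℕ) : Order.PFilter (Fr n) :=
  Order.IsPFilter.toPFilter (F := {a | KLevel n i ⊆ (interp n a : Set (KPt n))}) <|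
    Order.IsPFilter.of_def ⟨⊤, by simp⟩
      (fun a ha b hb => ⟨a ⊓ b, by
        simpa using ⟨ha, hb⟩, inf_le_left, inf_le_right⟩)
      (fun h ha => Set.Subset.trans ha (OrderHomClass.mono (interp n) h))

theorem mem_levelFilter {n i : ℕ} {a : Fr n} :
    a ∈ levelFilter n i ↔ KLevel n i ⊆ (interp n a : Set (KPt n)) := Iff.rfl

theorem levelFilter_anti {n i j : ℕ} (h : i ≤ j) : levelFilter n j ≤ levelFilter n i :=
  fun _ ha => mem_levelFilter.2 ((KLevel_mono n h).trans (mem_levelFilter.1 ha))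

/-- The quotient of the free Heyting algebra by the filter of all `a` with `K_n^i ⊆ ⟦a⟧`. -/
abbrev FrLevel (n i : ℕ) : Type := HQuot (levelFilter n i)

/-- The natural homomorphism from the `i`-th quotient to `O_↓(K_n^i)`: the class of `a` is sent to
`⟦a⟧ ∩ K_n^i`. -/
def FrLevel.trunc (n i : ℕ) : HeytingHom (FrLevel n i) (LowerSet (KLevel n i)) :=
  HQuot.lift (levelFilter n i) ((_root_.trunc n i).comp (interp n)) fun a ha => by
    ext w
    exact ⟨fun _ => trivial, fun _ => mem_levelFilter.1 ha w.2⟩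

/-!
# The profinite completion of a finitely generated free Heyting algebra

Everything rests on two facts about the model `K_n`.

*Universality.* Let `P` be a finite ordered set with an antitone valuation. Since every finite
decreasing set `Y ⊆ K_n` together with an admissible valuation `β` is realized by a point `w` with
`Iic w = insert w Y` (`KPt.exists_Iic_eq_insert`: `w` is `w_{β,Y}`, or the generator of `Y` when its
valuation is already `β`), recursion along `P` yields a valuation-preserving map `ρ : P → K_n` that
sends `Iic p` onto `Iic (ρ p)` (`KPt.exists_bounded_morphism`). The preimage under such a map is a
homomorphism of the algebras of decreasing sets. A finite Heyting algebra `H` is the algebra of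
decreasing subsets of its sup-irreducible elements, so every homomorphism from the free algebra to
`H` is `a ↦ ρ⁻¹ ⟦a⟧` for such a `ρ`; as the image of `ρ` lies in some `K_n^i`, the homomorphism
factors through the `i`-th level (`exists_levelFilter_le_top`).

*Rigidity.* For points `v`, `w` of `K_n`, the formulas true at `w` are true at `v` only if `v ≤ w`
(`KPt.le_of_theory_subset`). Because the sets `Iic w` are finite, having the same theory is a
bisimulation (`KPt.exists_le_theory_eq`, the intuitionistic Hennessy–Milner argument), and
bisimilar points of `K_n` are equal since two points with the same valuation and the same strict
predecessors are equal and no point just duplicates a single predecessor (`KPt.eq_of_lt_imp_le`).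
Hence every decreasing subset of the finite set `K_n^i` is cut out by a formula, which makes
`FrLevel.trunc` surjective.

The statements on projective limits are then formal: a compatible family of decreasing subsets of
the `K_n^i` glues to a decreasing subset of `K_n`, and the level filters are cofinal among the
filters with finite quotient.
-/

/-! ### Points of the generic Kripke model -/

namespace KPt

variable {n : ℕ}

/-- A symbol that occurs in some stage, as a point of the model. -/
def ofStage {d : ℕ} (s : Symb n) (h : s ∈ Symb.stage n d) : KPt n := ⟨s, d, h⟩

theorem lt_iff {v w : KPt n} : v < w ↔ v.1 ∈ w.1.below := by
  constructor
  · intro h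
    rcases h.le with h' | h'
    · exact h'
    · exact absurd (Subtype.ext h') h.ne
  · intro h
    refine lt_of_le_of_ne (Or.inl h) ?_
    rintro rfl
    exact Symb.notMem_below v.2.choose_spec h h

theorem exists_of_mem_below {w : KPt n} {s : Symb n} (h : s ∈ w.1.below) :
    ∃ v : KPt n, v.1 = s ∧ v < w := by
  obtain ⟨w, d, hd⟩ := w
  have hs : s ∈ Symb.stage n d :=
    Symb.below_subset (Symb.stage_mono d.le_succ hd) h
  exact ⟨⟨s, d, hs⟩, rfl, lt_iff.2 h⟩

theorem codes_subset {w : Symb n} : ∀ {d : ℕ}, w ∈ Symb.stage n (d + 1) →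
    (w.codes : Set ℕ) ⊆ Symb.code '' Symb.stage n d
  | 0, h => by
    have h : w.codes = ∅ := h
    simp [h]
  | d + 1, h => by
    rcases h with h | h
    · exact (codes_subset h).trans (Set.image_mono (Symb.stage_mono d.le_succ))
    · exact h.codes_subset

theorem ext_of_lt_iff {v w : KPt n} (hval : v.1.val = w.1.val) (h : ∀ u, u < v ↔ u < w) :
    v = w := by
  have hb : v.1.below = w.1.below := by
    ext s
    constructor
    · intro hs
      obtain ⟨u, rfl, hu⟩ := exists_of_mem_below hs
      exact lt_iff.1 ((h u).1 hu)
    · intro hs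
      obtain ⟨u, rfl, hu⟩ := exists_of_mem_below hs
      exact lt_iff.1 ((h u).2 hu)
  obtain ⟨d, hd⟩ := v.2
  obtain ⟨e, he⟩ := w.2
  have hd' : v.1 ∈ Symb.stage n (max d e + 1) :=
    Symb.stage_mono ((le_max_left d e).trans (Nat.le_succ _)) hd
  have he' : w.1 ∈ Symb.stage n (max d e + 1) :=
    Symb.stage_mono ((le_max_right d e).trans (Nat.le_succ _)) he
  exact Subtype.ext ((Symb.existsUnique_symb w.1.val (Symb.below_subset he')).unique
    ⟨hval, hb, codes_subset hd'⟩ ⟨rfl, rfl, codes_subset he'⟩)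

/-- Condition (iii) on the pairs `(β, Y)`, for all points of the model at once. -/
theorem val_ne_of_lt {v w : KPt n} (h : v < w) (hw : ∀ u < w, u ≤ v) : w.1.val ≠ v.1.val := by
  obtain ⟨d, hd⟩ := w.2
  induction d with
  | zero => exact absurd hd (Set.notMem_empty _)
  | succ d ih =>
    have hv := Symb.below_subset hd (lt_iff.1 h)
    match d, ih, hd, hv with
    | d + 1, ih, hd, hv =>
      rcases hd with hd | hd
      · exact ih hd
      · refine hd.val_ne v.1 hv ?_
        ext s
        constructor
        · intro hs
          obtain ⟨u, rfl, hu⟩ := exists_of_mem_below hs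
          exact ⟨Symb.below_subset (Or.inr hd : w.1 ∈ Symb.stage n (d + 2)) hs, hw u hu⟩
        · rintro ⟨hs, hsv⟩
          exact lt_iff.1 (lt_of_le_of_lt (show ofStage s hs ≤ v from hsv) h)

/-- The rigidity of the model: two points with the same valuation, whose strict predecessors lie
weakly below the other point, coincide. -/
theorem eq_of_lt_imp_le {v w : KPt n} (hval : v.1.val = w.1.val) (h : ∀ u < v, u ≤ w)
    (k : ∀ u < w, u ≤ v) : v = w := by
  by_cases hvw : v < w
  · exact absurd hval.symm (val_ne_of_lt hvw k)
  by_cases hwv : w < v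
  · exact absurd hval (val_ne_of_lt hwv h)
  refine ext_of_lt_iff hval fun u => ⟨fun hu => lt_of_le_of_ne (h u hu) ?_,
    fun hu => lt_of_le_of_ne (k u hu) ?_⟩
  · rintro rfl; exact hwv hu
  · rintro rfl; exact hvw hu

theorem finite_KLevel (n i : ℕ) : (KLevel n i).Finite :=
  (Symb.stage_finite n (i + 1)).preimage Subtype.val_injective.injOn

theorem exists_mem_KLevel (w : KPt n) : ∃ i, w ∈ KLevel n i := by
  obtain ⟨d, hd⟩ := w.2
  exact ⟨d, Symb.stage_mono d.le_succ hd⟩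

theorem finite_Iic (w : KPt n) : (Set.Iic w).Finite := by
  obtain ⟨i, hi⟩ := exists_mem_KLevel w
  exact (finite_KLevel n i).subset fun _ hv => KLevel_isLowerSet n i hv hi

instance : WellFoundedLT (KPt n) := by
  refine ⟨(InvImage.wf (fun w : KPt n => (Set.Iic w).ncard) wellFounded_lt).mono ?_⟩
  intro v w h
  exact Set.ncard_lt_ncard (Set.Iic_ssubset_Iic.2 h) (finite_Iic w)

theorem exists_subset_KLevel {Y : Set (KPt n)} (hY : Y.Finite) : ∃ i, Y ⊆ KLevel n i := by
  choose l hl using exists_mem_KLevel (n := n)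
  obtain ⟨i, hi⟩ := (hY.image l).bddAbove
  exact ⟨i, fun w hw => KLevel_mono n (hi ⟨w, hw, rfl⟩) (hl w)⟩

/-- Every finite decreasing set `Y` with an admissible valuation `β` is realized by a point. The
point is `w_{β,Y}`, unless `Y = Iic v` with `β` the valuation of `v`, when it is `v`. -/
theorem exists_Iic_eq_insert {Y : Set (KPt n)} (hfin : Y.Finite) (hlow : IsLowerSet Y)
    {β : Finset (Fin n)} (hβ : ∀ v ∈ Y, β ⊆ v.1.val) :
    ∃ w : KPt n, w.1.val = β ∧ Set.Iic w = insert w Y := by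
  classical
  by_cases hgen : ∃ v : KPt n, Y = Set.Iic v ∧ v.1.val = β
  · obtain ⟨v, rfl, hv⟩ := hgen
    exact ⟨v, hv, by simp⟩
  have himage (u : KPt n) : u.1 ∈ Subtype.val '' Y ↔ u ∈ Y :=
    Subtype.val_injective.mem_set_image
  have hex : ∃ d, Subtype.val '' Y ⊆ Symb.stage n d := by
    obtain ⟨i, hi⟩ := exists_subset_KLevel hfin
    exact ⟨i + 1, Set.image_subset_iff.2 hi⟩
  -- the least stage containing `Y` is the one at which `w_{β,Y}` has to be added
  obtain ⟨d, hd, hmin⟩ : ∃ d, Subtype.val '' Y ⊆ Symb.stage n d ∧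
      ∀ e < d, ¬ Subtype.val '' Y ⊆ Symb.stage n e :=
    ⟨Nat.find hex, Nat.find_spec hex, fun _ => Nat.find_min hex⟩
  obtain ⟨s, ⟨hsval, hsbelow, hscodes⟩, -⟩ := Symb.existsUnique_symb β hd
  have hs : s ∈ Symb.stage n (d + 1) := by
    match d, hd, hmin, hscodes with
    | 0, _, _, hscodes =>
      change s.codes = ∅
      simpa [Symb.stage, Set.subset_empty_iff] using hscodes
    | d + 1, hd, hmin, hscodes =>
      refine Or.inr ⟨hscodes, ?_, hsbelow ▸ hmin d d.lt_succ_self, ?_, ?_⟩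
      · rw [hsbelow]
        rintro _ ⟨v, hv, rfl⟩ u hu huv
        exact ⟨ofStage u hu, hlow (show ofStage u hu ≤ v from huv) hv, rfl⟩
      · rw [hsbelow]
        rintro _ ⟨v, hv, rfl⟩
        exact hsval ▸ hβ v hv
      · rw [hsbelow, hsval]
        intro v hv hYv e
        refine hgen ⟨ofStage v hv, ?_, e.symm⟩
        ext u
        rw [← himage, hYv]
        refine ⟨fun h => h.2, fun h => ⟨?_, h⟩⟩
        rcases h with h | h
        · exact Symb.stage_mono d.le_succ (Symb.below_subset hv h)
        · exact h ▸ hv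
  refine ⟨ofStage s hs, hsval, ?_⟩
  ext u
  rw [Set.mem_Iic, le_iff_eq_or_lt, Set.mem_insert_iff, lt_iff]
  change _ ∨ u.1 ∈ s.below ↔ _
  rw [hsbelow, himage]

/-! ### Universality of the model -/

/-- Every finite Kripke model maps to the generic one by a valuation-preserving map that sends
principal lower sets onto principal lower sets. -/
theorem exists_bounded_morphism {P : Type*} [PartialOrder P] [Finite P]
    (val : P → Finset (Fin n)) (hval : Antitone val) :
    ∃ ρ : P → KPt n, (∀ p, (ρ p).1.val = val p) ∧ ∀ p, ρ '' Set.Iic p = Set.Iic (ρ p) := by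
  have hne : Nonempty (KPt n) := ⟨⟨⟨∅, ∅⟩, 1, rfl⟩⟩
  have key : ∀ (β : Finset (Fin n)) (Y : Set (KPt n)), ∃ w : KPt n,
      Y.Finite → IsLowerSet Y → (∀ v ∈ Y, β ⊆ v.1.val) →
        w.1.val = β ∧ Set.Iic w = insert w Y := by
    intro β Y
    by_cases h : Y.Finite ∧ IsLowerSet Y ∧ ∀ v ∈ Y, β ⊆ v.1.val
    · obtain ⟨w, hw⟩ := exists_Iic_eq_insert h.1 h.2.1 h.2.2
      exact ⟨w, fun _ _ _ => hw⟩
    · exact ⟨hne.some, fun h1 h2 h3 => absurd ⟨h1, h2, h3⟩ h⟩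
  choose F hF using key
  let ρ : P → KPt n := (wellFounded_lt (α := P)).fix fun p ih =>
    F (val p) (Set.range fun q : Set.Iio p => ih q.1 q.2)
  have hρ : ∀ p, ρ p = F (val p) (ρ '' Set.Iio p) := by
    intro p
    rw [Set.image_eq_range]
    exact WellFounded.fix_eq _ _ _
  have main : ∀ p, (ρ p).1.val = val p ∧ ρ '' Set.Iic p = Set.Iic (ρ p) := by
    intro p
    induction p using (wellFounded_lt (α := P)).induction with
    | _ p ih =>
      have h := hF (val p) (ρ '' Set.Iio p) (Set.toFinite _) ?_ ?_
      · rw [← hρ p] at h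
        refine ⟨h.1, ?_⟩
        rw [h.2, ← Set.Iio_insert, Set.image_insert_eq]
      · rintro _ u hu ⟨q, hq, rfl⟩
        have : u ∈ ρ '' Set.Iic q := (ih q hq).2 ▸ hu
        obtain ⟨r, hr, rfl⟩ := this
        exact ⟨r, lt_of_le_of_lt hr hq, rfl⟩
      · rintro _ ⟨q, hq, rfl⟩
        rw [(ih q hq).1]
        exact hval (le_of_lt hq)
  exact ⟨ρ, fun p => (main p).1, fun p => (main p).2⟩

end KPt

/-- Preimage under a map that sends principal lower sets onto principal lower sets, as a
homomorphism of the Heyting algebras of lower sets. -/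
def LowerSet.preimageHom {P X : Type*} [PartialOrder P] [PartialOrder X] (ρ : P → X)
    (hρ : ∀ p, ρ '' Set.Iic p = Set.Iic (ρ p)) : HeytingHom (LowerSet X) (LowerSet P) where
  toFun A := ⟨ρ ⁻¹' A, fun p q h hp => A.lower (by
    have : ρ q ∈ ρ '' Set.Iic p := ⟨q, h, rfl⟩
    rwa [hρ] at this) hp⟩
  map_sup' _ _ := rfl
  map_inf' _ _ := rfl
  map_bot' := rfl
  map_himp' A B := by
    ext p
    refine Iff.trans (LowerSet.mem_himp_iff A B (ρ p)) (Iff.trans ?_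
      (LowerSet.mem_himp_iff _ _ p).symm)
    constructor
    · intro h q hq
      refine h (ρ q) ?_
      rw [← Set.mem_Iic, ← hρ]
      exact ⟨q, hq, rfl⟩
    · intro h v hv
      rw [← Set.mem_Iic, ← hρ] at hv
      obtain ⟨q, hq, rfl⟩ := hv
      exact h q hq

theorem mem_interp_gen {n : ℕ} {j : Fin n} {w : KPt n} :
    w ∈ interp n (Fr.gen j) ↔ j ∈ w.1.val := Iff.rfl

/-- Every homomorphism from the free algebra to the lower sets of a finite ordered set is the
interpretation in the generic model, pulled back along some map. -/
theorem exists_interp_preimage {n : ℕ} {P : Type*} [PartialOrder P] [Finite P]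
    (f : HeytingHom (Fr n) (LowerSet P)) :
    ∃ ρ : P → KPt n, ∀ a p, p ∈ f a ↔ ρ p ∈ interp n a := by
  classical
  obtain ⟨ρ, hval, hρ⟩ := KPt.exists_bounded_morphism (n := n)
    (fun p : P => Finset.univ.filter fun j => p ∈ f (Fr.gen j)) (fun p q h j hj => by
      rw [Finset.mem_filter] at hj ⊢
      exact ⟨hj.1, (f (Fr.gen j)).lower h hj.2⟩)
  have h : f = (LowerSet.preimageHom ρ hρ).comp (interp n) := by
    refine (Fr.existsUnique_lift fun j => f (Fr.gen j)).unique (fun _ => rfl) fun j => ?_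
    ext p
    change ρ p ∈ interp n (Fr.gen j) ↔ p ∈ f (Fr.gen j)
    rw [mem_interp_gen, hval]
    simp
  refine ⟨ρ, fun a p => ?_⟩
  rw [h]
  rfl

theorem exists_levelFilter_le_top {n : ℕ} {H : Type*} [HeytingAlgebra H] [Finite H]
    (f : HeytingHom (Fr n) H) : ∃ i, ∀ a ∈ levelFilter n i, f a = ⊤ := by
  classical
  have := Fintype.ofFinite H
  -- Birkhoff duality represents `H` as the lower sets of its sup-irreducible elements
  let e : H ≃o LowerSet {a : H // SupIrred a} := OrderIso.lowerSetSupIrred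
  obtain ⟨ρ, hρ⟩ := exists_interp_preimage ((e : HeytingHom H (LowerSet {a : H // SupIrred a})).comp f)
  obtain ⟨i, hi⟩ := KPt.exists_subset_KLevel (Set.finite_range ρ)
  refine ⟨i, fun a ha => e.injective ?_⟩
  rw [map_top]
  refine top_le_iff.1 fun p _ => ?_
  exact (hρ a p).2 (mem_levelFilter.1 ha (hi ⟨p, rfl⟩))

/-! ### Rigidity of the model and definability of lower sets -/

theorem mem_interp_himp {n : ℕ} {a b : Fr n} {w : KPt n} :
    w ∈ interp n (a ⇨ b) ↔ ∀ v ≤ w, v ∈ interp n a → v ∈ interp n b := by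
  rw [map_himp]
  exact LowerSet.mem_himp_iff _ _ _

theorem mem_interp_finset_inf {n : ℕ} {ι : Type*} {s : Finset ι} {a : ι → Fr n} {w : KPt n} :
    w ∈ interp n (s.inf a) ↔ ∀ i ∈ s, w ∈ interp n (a i) := by
  rw [map_finset_inf, Finset.inf_eq_iInf]
  simp

theorem mem_interp_finset_sup {n : ℕ} {ι : Type*} {s : Finset ι} {a : ι → Fr n} {w : KPt n} :
    w ∈ interp n (s.sup a) ↔ ∃ i ∈ s, w ∈ interp n (a i) := by
  rw [map_finset_sup, Finset.sup_eq_iSup]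
  simp

namespace KPt

variable {n : ℕ}

/-- The set of all formulas true at a point of the generic model. -/
def theory (w : KPt n) : Set (Fr n) := {a | w ∈ interp n a}

theorem theory_anti {v w : KPt n} (h : v ≤ w) : w.theory ⊆ v.theory :=
  fun a ha => (interp n a).lower h ha

theorem val_eq_of_theory_eq {v w : KPt n} (h : v.theory = w.theory) : v.1.val = w.1.val := by
  ext j
  exact Set.ext_iff.1 h (Fr.gen j)

/-- Having the same theory is a bisimulation. If no `t ≤ w` had the theory of `u`, there would be
for each of these finitely many `t` a formula `a t` true at `t` only, or a formula `b t` true at `u`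
only; then `⋀ b t ⇨ ⋁ a t` would be true at `w` and false at `u`. -/
theorem exists_le_theory_eq {u w : KPt n} (h : w.theory ⊆ u.theory) :
    ∃ t ≤ w, t.theory = u.theory := by
  classical
  by_contra! hne
  have key : ∀ t : KPt n, ∃ a b : Fr n, u ∉ interp n a ∧ u ∈ interp n b ∧
      (t ≤ w → t ∈ interp n b → t ∈ interp n a) := by
    intro t
    by_cases htw : t ≤ w
    · by_cases hsub : t.theory ⊆ u.theory
      · obtain ⟨b, hbu, hbt⟩ := Set.not_subset.1 fun h' => hne t htw (hsub.antisymm h')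
        exact ⟨⊥, b, by simp, hbu, fun _ hb => absurd hb hbt⟩
      · obtain ⟨a, hat, hau⟩ := Set.not_subset.1 hsub
        exact ⟨a, ⊤, hau, by simp, fun _ _ => hat⟩
    · exact ⟨⊥, ⊤, by simp, by simp, fun h => absurd h htw⟩
  choose a b ha hb hab using key
  let s := (finite_Iic w).toFinset
  have hw : (s.inf b ⇨ s.sup a) ∈ w.theory := mem_interp_himp.2 fun t ht hbt => by
    have hts : t ∈ s := by simpa [s] using ht
    exact mem_interp_finset_sup.2 ⟨t, hts, hab t ht (mem_interp_finset_inf.1 hbt t hts)⟩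
  obtain ⟨t, -, ht⟩ := mem_interp_finset_sup.1 <|
    mem_interp_himp.1 (h hw) u le_rfl (mem_interp_finset_inf.2 fun t _ => hb t)
  exact ha t ht

theorem theory_injective : Function.Injective (theory : KPt n → Set (Fr n)) := by
  intro v
  induction v using (wellFounded_lt (α := KPt n)).induction with
  | _ v ihv =>
    intro w
    induction w using (wellFounded_lt (α := KPt n)).induction with
    | _ w ihw =>
      intro h
      refine eq_of_lt_imp_le (val_eq_of_theory_eq h) (fun u hu => ?_) fun t ht => ?_
      · obtain ⟨t, ht, e⟩ := exists_le_theory_eq (h ▸ theory_anti hu.le : w.theory ⊆ u.theory)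
        exact ihv u hu e.symm ▸ ht
      · obtain ⟨s, hs, e⟩ := exists_le_theory_eq (h ▸ theory_anti ht.le : v.theory ⊆ t.theory)
        rcases hs.lt_or_eq with hs' | rfl
        · exact ihv s hs' e ▸ hs
        · exact (ihw t ht e).ge

theorem le_of_theory_subset {v w : KPt n} (h : w.theory ⊆ v.theory) : v ≤ w := by
  obtain ⟨t, ht, e⟩ := exists_le_theory_eq h
  exact theory_injective e ▸ ht

end KPt

/-- Every decreasing subset of `K_n^i` is defined by a formula. -/
theorem exists_trunc_interp_eq {n i : ℕ} (X : LowerSet (KLevel n i)) :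
    ∃ a, trunc n i (interp n a) = X := by
  classical
  have := (KPt.finite_KLevel n i).fintype
  have key : ∀ v w : KLevel n i, ∃ a : Fr n, (w : KPt n) ∈ interp n a ∧
      (¬ v ≤ w → (v : KPt n) ∉ interp n a) := by
    intro v w
    by_cases h : v ≤ w
    · exact ⟨⊤, by simp, fun h' => absurd h h'⟩
    · obtain ⟨a, ha, hb⟩ := Set.not_subset.1 fun h' => h (KPt.le_of_theory_subset h')
      exact ⟨a, ha, fun _ => hb⟩
  choose a ha hb using key
  refine ⟨(Finset.univ.filter (· ∈ X)).sup fun w => Finset.univ.inf fun v => a v w, ?_⟩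
  ext v
  change (v : KPt n) ∈ interp n _ ↔ v ∈ X
  rw [mem_interp_finset_sup]
  constructor
  · rintro ⟨w, hw, h⟩
    rw [Finset.mem_filter] at hw
    have hv := mem_interp_finset_inf.1 h v (Finset.mem_univ v)
    by_contra hvX
    exact hb v w (fun hvw => hvX (X.lower hvw hw.2)) hv
  · intro hv
    exact ⟨v, by simpa using hv, mem_interp_finset_inf.2 fun u _ => ha u v⟩

/-! ### Quotients by filters and the finite levels -/

section Quotients

variable {A : Type*} [HeytingAlgebra A]

theorem HQuot.mk_surjective (Φ : Order.PFilter A) : Function.Surjective (HQuot.mk Φ) :=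
  Quotient.mk_surjective

theorem HQuot.mem_of_mk_eq_top (Φ : Order.PFilter A) {a : A} (h : HQuot.mk Φ a = ⊤) : a ∈ Φ := by
  have h : (a ⇨ ⊤) ⊓ (⊤ ⇨ a) ∈ Φ := Quotient.exact (s := filterSetoid Φ) h
  simpa using h

theorem HQuot.factor_mk {Φ Ψ : Order.PFilter A} (h : Φ ≤ Ψ) (a : A) :
    HQuot.factor h (HQuot.mk Φ a) = HQuot.mk Ψ a := rfl

theorem HQuot.factor_factor {Φ Ψ Χ : Order.PFilter A} (h : Φ ≤ Ψ) (k : Ψ ≤ Χ) (x : HQuot Φ) :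
    HQuot.factor k (HQuot.factor h x) = HQuot.factor (h.trans k) x := by
  obtain ⟨a, rfl⟩ := HQuot.mk_surjective Φ x
  rfl

theorem HQuot.factor_self {Φ : Order.PFilter A} (h : Φ ≤ Φ) (x : HQuot Φ) :
    HQuot.factor h x = x := by
  obtain ⟨a, rfl⟩ := HQuot.mk_surjective Φ x
  rfl

end Quotients

namespace FrLevel

variable {n : ℕ}

theorem trunc_mk (i : ℕ) (a : Fr n) :
    FrLevel.trunc n i (HQuot.mk (levelFilter n i) a) = _root_.trunc n i (interp n a) := rfl

theorem trunc_bijective (n i : ℕ) : Function.Bijective (FrLevel.trunc n i) := by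
  constructor
  · intro x y h
    obtain ⟨a, rfl⟩ := HQuot.mk_surjective _ x
    obtain ⟨b, rfl⟩ := HQuot.mk_surjective _ y
    rw [trunc_mk, trunc_mk] at h
    have h' (w : KPt n) (hw : w ∈ KLevel n i) : w ∈ interp n a ↔ w ∈ interp n b :=
      SetLike.ext_iff.1 h ⟨w, hw⟩
    refine Quotient.sound (s := filterSetoid _) (Order.PFilter.inf_mem ?_ ?_)
    · exact mem_levelFilter.2 fun w hw => mem_interp_himp.2 fun v hv =>
        (h' v (KLevel_isLowerSet n i hv hw)).1
    · exact mem_levelFilter.2 fun w hw => mem_interp_himp.2 fun v hv =>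
        (h' v (KLevel_isLowerSet n i hv hw)).2
  · intro X
    obtain ⟨a, ha⟩ := exists_trunc_interp_eq X
    exact ⟨HQuot.mk _ a, ha⟩

theorem finite (n i : ℕ) : Finite (FrLevel n i) := by
  have := (KPt.finite_KLevel n i).to_subtype
  have : Finite (LowerSet (KLevel n i)) :=
    Finite.of_injective (fun X => (X : Set (KLevel n i))) SetLike.coe_injective
  exact Finite.of_injective _ (trunc_bijective n i).1

theorem mem_trunc_factor {i j : ℕ} (h : i ≤ j) (x : FrLevel n j) (w : KPt n)
    (hw : w ∈ KLevel n i) :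
    ⟨w, hw⟩ ∈ FrLevel.trunc n i (HQuot.factor (levelFilter_anti h) x) ↔
      ⟨w, KLevel_mono n h hw⟩ ∈ FrLevel.trunc n j x := by
  obtain ⟨a, rfl⟩ := HQuot.mk_surjective _ x
  rfl

/-- The inverse of `FrLevel.trunc`. -/
noncomputable def truncSymm (n i : ℕ) : HeytingHom (LowerSet (KLevel n i)) (FrLevel n i) :=
  let e := Equiv.ofBijective _ (trunc_bijective n i)
  { toFun := e.symm
    map_sup' := fun X Y => e.injective <| by
      rw [e.apply_symm_apply]
      refine Eq.symm ((map_sup (FrLevel.trunc n i) _ _).trans ?_)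
      exact congrArg₂ _ (e.apply_symm_apply X) (e.apply_symm_apply Y)
    map_inf' := fun X Y => e.injective <| by
      rw [e.apply_symm_apply]
      refine Eq.symm ((map_inf (FrLevel.trunc n i) _ _).trans ?_)
      exact congrArg₂ _ (e.apply_symm_apply X) (e.apply_symm_apply Y)
    map_bot' := e.injective <| by
      rw [e.apply_symm_apply]
      exact (map_bot (FrLevel.trunc n i)).symm
    map_himp' := fun X Y => e.injective <| by
      rw [e.apply_symm_apply]
      refine Eq.symm ((map_himp (FrLevel.trunc n i) _ _).trans ?_)
      exact congrArg₂ _ (e.apply_symm_apply X) (e.apply_symm_apply Y) }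

theorem trunc_truncSymm (i : ℕ) (X : LowerSet (KLevel n i)) :
    FrLevel.trunc n i (truncSymm n i X) = X :=
  (Equiv.ofBijective _ (trunc_bijective n i)).apply_symm_apply X

end FrLevel

/-! ### The projective limit of the levels -/

namespace FrHat

variable {n : ℕ}

/-- The projection of `O_↓(K_n)` to the `i`-th level: truncation to `K_n^i`, transported along the
isomorphism `FrLevel.trunc`. -/
noncomputable def proj (n i : ℕ) : HeytingHom (FrHat n) (FrLevel n i) :=
  (FrLevel.truncSymm n i).comp (trunc n i)

theorem trunc_proj (i : ℕ) (X : FrHat n) : FrLevel.trunc n i (proj n i X) = trunc n i X :=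
  FrLevel.trunc_truncSymm i _

theorem proj_interp (i : ℕ) (a : Fr n) :
    proj n i (interp n a) = HQuot.mk (levelFilter n i) a :=
  (FrLevel.trunc_bijective n i).1 (trunc_proj i _)

theorem factor_proj {i j : ℕ} (h : i ≤ j) (X : FrHat n) :
    HQuot.factor (levelFilter_anti h) (proj n j X) = proj n i X := by
  refine (FrLevel.trunc_bijective n i).1 ?_
  refine SetLike.ext fun ⟨w, hw⟩ => ?_
  rw [FrLevel.mem_trunc_factor h, trunc_proj, trunc_proj]
  rfl

theorem isProjLimit_proj (n : ℕ) :
    IsProjLimit (FrLevel n) (fun _ _ h => HQuot.factor (levelFilter_anti h)) (FrHat n)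
      (proj n) where
  compat _ _ h X := factor_proj h X
  existsUnique y hy := by
    have hmem {i j : ℕ} (w : KPt n) (hi : w ∈ KLevel n i) (hj : w ∈ KLevel n j) :
        ⟨w, hi⟩ ∈ FrLevel.trunc n i (y i) ↔ ⟨w, hj⟩ ∈ FrLevel.trunc n j (y j) := by
      rw [← hy i _ (le_max_left i j), ← hy j _ (le_max_right i j),
        FrLevel.mem_trunc_factor (le_max_left i j), FrLevel.mem_trunc_factor (le_max_right i j)]
    let X : FrHat n :=
      ⟨{w | ∃ i, ∃ h : w ∈ KLevel n i, ⟨w, h⟩ ∈ FrLevel.trunc n i (y i)}, by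
        rintro w v hvw ⟨i, h, hw⟩
        exact ⟨i, KLevel_isLowerSet n i hvw h, (FrLevel.trunc n i (y i)).lower
          (show (⟨v, _⟩ : KLevel n i) ≤ ⟨w, h⟩ from hvw) hw⟩⟩
    refine ⟨X, fun i => (FrLevel.trunc_bijective n i).1 ?_, fun Z hZ => ?_⟩
    · rw [trunc_proj]
      ext ⟨w, hw⟩
      exact ⟨fun ⟨j, hj, h⟩ => (hmem w hw hj).2 h, fun h => ⟨i, hw, h⟩⟩
    · have hZ' (w : KPt n) (i : ℕ) (h : w ∈ KLevel n i) :
          w ∈ Z ↔ ⟨w, h⟩ ∈ FrLevel.trunc n i (y i) := by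
        rw [← hZ i, trunc_proj]
        rfl
      ext w
      constructor
      · intro hw
        obtain ⟨i, hi⟩ := KPt.exists_mem_KLevel w
        exact ⟨i, hi, (hZ' w i hi).1 hw⟩
      · rintro ⟨i, hi, h⟩
        exact (hZ' w i hi).2 h

/-! ### The profinite completion -/

/-- The level filters are cofinal among the filters with finite quotient. -/
theorem exists_levelFilter_le (Φ : FinFilter (Fr n)) : ∃ i, levelFilter n i ≤ Φ.1 := by
  have := Φ.2
  obtain ⟨i, hi⟩ := exists_levelFilter_le_top (HQuot.mk Φ.1)
  exact ⟨i, fun a ha => HQuot.mem_of_mk_eq_top _ (hi a ha)⟩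

/-- The projection of `O_↓(K_n)` to a finite quotient of the free Heyting algebra, by way of some
level that dominates it. -/
noncomputable def finProj (Φ : FinFilter (Fr n)) : HeytingHom (FrHat n) (HQuot Φ.1) :=
  (HQuot.factor (exists_levelFilter_le Φ).choose_spec).comp (proj n _)

/-- The projection to a finite quotient may be computed on any level that dominates it. -/
theorem finProj_apply (Φ : FinFilter (Fr n)) {i : ℕ} (h : levelFilter n i ≤ Φ.1) (X : FrHat n) :
    finProj Φ X = HQuot.factor h (proj n i X) := by
  change HQuot.factor (exists_levelFilter_le Φ).choose_spec (proj n _ X) = _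
  rw [← factor_proj (le_max_left _ i), ← factor_proj (le_max_right _ i), HQuot.factor_factor,
    HQuot.factor_factor]

theorem finProj_levelFilter (i : ℕ) (h : Finite (FrLevel n i)) :
    finProj ⟨levelFilter n i, h⟩ = proj n i := by
  ext X : 1
  rw [finProj_apply ⟨levelFilter n i, h⟩ le_rfl, HQuot.factor_self]

theorem finProj_interp (Φ : FinFilter (Fr n)) (a : Fr n) :
    finProj Φ (interp n a) = HQuot.mk Φ.1 a := by
  obtain ⟨i, hi⟩ := exists_levelFilter_le Φ
  rw [finProj_apply Φ hi, proj_interp, HQuot.factor_mk]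

theorem isProfiniteCompletion_finProj (n : ℕ) :
    IsProfiniteCompletion (Fr n) (FrHat n) finProj where
  compat Φ Ψ h X := by
    obtain ⟨i, hi⟩ := exists_levelFilter_le Ψ
    rw [finProj_apply Ψ hi, finProj_apply Φ (hi.trans h)]
    exact HQuot.factor_factor hi h _
  existsUnique y hy := by
    let lev (i : ℕ) : FinFilter (Fr n) := ⟨levelFilter n i, FrLevel.finite n i⟩
    obtain ⟨X, hX, huniq⟩ := (isProjLimit_proj n).existsUnique (fun i => y (lev i))
      fun i j h => hy (lev i) (lev j) (levelFilter_anti h)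
    refine ⟨X, fun Φ => ?_, fun Z hZ => huniq Z fun i => ?_⟩
    · obtain ⟨i, hi⟩ := exists_levelFilter_le Φ
      rw [finProj_apply Φ hi, hX]
      exact hy Φ (lev i) hi
    · rw [← finProj_levelFilter i (FrLevel.finite n i)]
      exact hZ (lev i)

end FrHat

theorem mainTheorem1 (n : ℕ) (hn : 0 < n) :
    -- The quotients by the level filters are finite and isomorphic to `O_↓(K_n^i)` via truncation.
    (∀ i, Finite (FrLevel n i) ∧ Function.Bijective (FrLevel.trunc n i)) ∧
    -- Every finite quotient of the free Heyting algebra factors through some level.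
    (∀ (H : Type*) [HeytingAlgebra H] [Finite H] (f : HeytingHom (Fr n) H),
      Function.Surjective f →
        ∃ (i : ℕ) (g : HeytingHom (FrLevel n i) H),
          ∀ a, g (HQuot.mk (levelFilter n i) a) = f a) ∧
    -- `O_↓(K_n)` is the projective limit of the levels, and the profinite completion.
    ∃ (p : ∀ i, HeytingHom (FrHat n) (FrLevel n i))
      (q : ∀ Φ : FinFilter (Fr n), HeytingHom (FrHat n) (HQuot Φ.1)),
      (∀ i X, FrLevel.trunc n i (p i X) = trunc n i X) ∧
      (∀ i a, p i (interp n a) = HQuot.mk (levelFilter n i) a) ∧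
      IsProjLimit (FrLevel n) (fun _ _ h => HQuot.factor (levelFilter_anti h)) (FrHat n) p ∧
      (∀ Φ a, q Φ (interp n a) = HQuot.mk Φ.1 a) ∧
      (∀ i (h : Finite (FrLevel n i)), q ⟨levelFilter n i, h⟩ = p i) ∧
      IsProfiniteCompletion (Fr n) (FrHat n) q := by
  refine ⟨fun i => ⟨FrLevel.finite n i, FrLevel.trunc_bijective n i⟩, ?_,
    FrHat.proj n, FrHat.finProj, FrHat.trunc_proj, FrHat.proj_interp, FrHat.isProjLimit_proj n,
    FrHat.finProj_interp, FrHat.finProj_levelFilter, FrHat.isProfiniteCompletion_finProj n⟩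
  intro H _ _ f _
  obtain ⟨i, hi⟩ := exists_levelFilter_le_top f
  exact ⟨i, HQuot.lift (levelFilter n i) f hi, fun _ => rfl⟩
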